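/- Let $V$ be a two-sided quaternionic Banach space and let $T$ be a closed (right or left) linear quaternionic operator on $V$ with domain $\mathcal D(T)$. Its S-resolvent set is $$\rho_S(T)=\{s\in\mathbb H:\ (T^2-2\operatorname{Re}(s)T+|s|^2 I)^{-1}\in\mathcal B(V)\},$$ where $T^2-2\operatorname{Re}(s)T+|s|^2I$ has domain $\mathcal D(T^2)$ and $\mathcal B(V)$ is the set of bounded everywhere defined linear operators on $V$ (with the same side of linearity as $T$). Its S-spectrum is $\sigma_S(T)=\mathbb H\setminus\rho_S(T)$, and its extended S-spectrum $\overline{\sigma_S}(T)\subset\mathbb H\cup\{\infty\}$ is $\sigma_S(T)$ if $T\in\mathcal B(V)$ and $\sigma_S(T)\cup\{\infty\}$ otherwise. Assume $\rho_S(T)\neq\emptyset$. An intrinsic rational function is a quotient $R=PQ^{-1}$ of polynomials with real coefficients, $Q\ne0$. Its poles are the zeros in $\mathbb H$ of the denominator of its reduced form. If $R$ has no poles on $\sigma_S(T)$, then $R(T):=P(T)Q(T)^{-1}$, where $PQ^{-1}$ is the reduced form of $R$; here a polynomial $P(T)=\sum_{\ell}a_\ell T^\ell$ has domain $\mathcal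 D(T^{\deg P})$, and sums and products of operators have their natural domains. $R$ is extended to $\mathbb H\cup\{\infty\}$ by $R(\infty)=\lim_{|q|\to\infty}R(q)$ and by the value $\infty$ at the poles. For operators, $A\subset B$ means that $B$ extends $A$. **Proposition 3.11.** Let $0\neq R=PQ^{-1}$ and $R_1=P_1Q_1^{-1}$ be intrinsic rational functions ($P,Q,P_1,Q_1$ real polynomials, $Q,Q_1\neq0$), and assume that $R$ has no poles on $\sigma_S(T)$; in (iii) and (iv) assume the same of $R_1$. Then: (i) $R(T)$ is a closed operator. (ii) $R(\overline{\sigma_S}(T))\subset\overline{\sigma_S}(R(T))$. (iii) $R(T)R_1(T)\subset(RR_1)(T)$, and equality holds if $(\deg P-\deg Q)(\deg P_1-\deg Q_1)\ge0$. (iv) $R(T)+R_1(T)\subset(R+R_1)(T)$, and equality holds if $\deg(PQ_1+P_1Q)=\max\{\deg(PQ_1),\deg(P_1Q)\}$. (In the degree conditions the zero polynomial may be given degree $0$.) -/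

import Mathlib

open scoped Quaternion Polynomial

/-! ### Partially defined operators

An operator on `V`, linear over the ring `A`, is a `LinearPMap`, i.e. a linear map on a submodule of
`V`, its domain. With `A = ℍᵐᵒᵖ` these are the right linear quaternionic operators, with `A = ℍ` the
left linear ones. Sums and real multiples are those of Mathlib: the domain of a sum is the
intersection of the domains, and `r • T` has the domain of `T`. -/

section Operators

variable {A V : Type*} [Ring A] [NormedAddCommGroup V] [Module A V]

/-- The composition `g f` of partially defined operators, with its natural domain
`{v ∈ D(f) | f v ∈ D(g)}`. -/
noncomputable def opComp (g f : V →ₗ.[A] V) : V →ₗ.[A] V :=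
  g.comp (f.domRestrict ((g.domain.comap f.toFun).map f.domain.subtype)) (by
    rintro ⟨x, hx, hx'⟩
    obtain ⟨y, hy, rfl⟩ := hx
    exact hy)

theorem mem_domain_opComp (g f : V →ₗ.[A] V) (v : V) :
    v ∈ (opComp g f).domain ↔ ∃ h : v ∈ f.domain, f ⟨v, h⟩ ∈ g.domain := by
  constructor
  · rintro ⟨hx, hx'⟩
    obtain ⟨y, hy, rfl⟩ := hx
    exact ⟨hx', hy⟩
  · rintro ⟨h, h'⟩
    exact ⟨⟨⟨v, h⟩, h', rfl⟩, h⟩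

theorem opComp_apply (g f : V →ₗ.[A] V) (v : V) (hv : v ∈ (opComp g f).domain)
    (h : v ∈ f.domain) (h' : f ⟨v, h⟩ ∈ g.domain) :
    opComp g f ⟨v, hv⟩ = g ⟨f ⟨v, h⟩, h'⟩ := rfl

variable [Algebra ℝ A] [NormedSpace ℝ V] [IsScalarTower ℝ A V]

/-- The powers of an operator: `T ^ 0 = I` and `T ^ (n + 1) = T (T ^ n)`, with the natural domains. -/
noncomputable def opPow (T : V →ₗ.[A] V) : ℕ → (V →ₗ.[A] V)
  | 0 => LinearMap.id.toPMap ⊤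
  | n + 1 => opComp T (opPow T n)

/-- The operator is closed: its graph is a closed set. -/
def IsClosedOp (T : V →ₗ.[A] V) : Prop :=
  IsClosed {x : V × V | x ∈ T.graph}

/-- The operator is bounded and everywhere defined, i.e. it belongs to `B(V)`. -/
def IsBoundedOp (T : V →ₗ.[A] V) : Prop :=
  ∃ B : V →L[A] V, T = (B : V →ₗ[A] V).toPMap ⊤

/-- `L⁻¹ ∈ B(V)`: the operator `L` has a two-sided inverse that is bounded and defined on all of
`V`. -/
def HasBoundedInverse (L : V →ₗ.[A] V) : Prop :=
  ∃ B : V →L[A] V, (∀ v : L.domain, B (L v) = v) ∧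
    ∀ w : V, ∃ h : B w ∈ L.domain, L ⟨B w, h⟩ = w

/-- The operator `T² - 2 Re(s) T + |s|² I` on the domain of `T²`. -/
noncomputable def sOp (T : V →ₗ.[A] V) (s : ℍ) : V →ₗ.[A] V :=
  opPow T 2 + (-(2 * s.re)) • T + (‖s‖ ^ 2) • opPow T 0

/-- The S-resolvent set of `T`. -/
def sResolventSet (T : V →ₗ.[A] V) : Set ℍ :=
  {s | HasBoundedInverse (sOp T s)}

/-- The S-spectrum of `T`. -/
def sSpectrum (T : V →ₗ.[A] V) : Set ℍ :=
  (sResolventSet T)ᶜ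

/-- The extended S-spectrum of `T`, in `ℍ ∪ {∞}`: the point `∞` is adjoined to the S-spectrum if `T`
is not a bounded everywhere defined operator. -/
def extSSpectrum (T : V →ₗ.[A] V) : Set (OnePoint ℍ) :=
  (fun s : ℍ => (s : OnePoint ℍ)) '' sSpectrum T ∪ {x | x = OnePoint.infty ∧ ¬ IsBoundedOp T}

/-- `P(T) = ∑ aₗ Tˡ` (sum over `l ≤ deg P`) for a polynomial with real coefficients; its domain is
that of `T ^ deg P`. -/
noncomputable def polyOp (P : ℝ[X]) (T : V →ₗ.[A] V) : V →ₗ.[A] V :=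
  ∑ l ∈ Finset.range (P.natDegree + 1), P.coeff l • opPow T l

/-- The rational functional calculus `R(T) = P(T) Q(T)⁻¹`, where `R = P Q⁻¹` in lowest terms. It is
used only if `R` has no poles on the S-spectrum of `T`, where `Q(T)` is injective. -/
noncomputable def ratOp (R : RatFunc ℝ) (T : V →ₗ.[A] V) : V →ₗ.[A] V :=
  opComp (polyOp R.num T) (polyOp R.denom T).inverse

end Operators

/-! ### Intrinsic rational functions

A quaternionic polynomial is intrinsic if it maps each complex plane `ℂᵢ` into itself; these are
exactly the polynomials with real coefficients. So the intrinsic rational functions are the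
quotients of real polynomials, considered as functions of a quaternionic variable. -/

/-- `p` maps each plane `ℂᵢ = {u + i v}`, where `i² = -1`, into itself. -/
def IsIntrinsicPoly (p : Polynomial ℍ) : Prop :=
  ∀ i : ℍ, i * i = -1 → ∀ u v : ℝ, ∃ a b : ℝ, p.eval ((u : ℍ) + v • i) = (a : ℍ) + b • i

theorem isIntrinsicPoly_iff (p : Polynomial ℍ) :
    IsIntrinsicPoly p ↔ ∃ p₀ : ℝ[X], p = p₀.map (algebraMap ℝ ℍ) := by
  constructor
  · intro h
    have comp : ∀ f : ℍ →ₗ[ℝ] ℝ, (∀ x : ℝ, f (p.eval (x : ℍ)) = 0) → ∀ n, f (p.coeff n) = 0 := by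
      intro f hf n
      let q : ℝ[X] := ∑ k ∈ Finset.range (p.natDegree + 1), Polynomial.monomial k (f (p.coeff k))
      have hq : q = 0 := by
        refine Polynomial.funext fun x => ?_
        have h1 : f (p.eval (x : ℍ)) = 0 := hf x
        rw [Polynomial.eval_eq_sum_range, map_sum] at h1
        rw [Polynomial.eval_zero, ← h1]
        simp only [q, Polynomial.eval_finsetSum, Polynomial.eval_monomial]
        refine Finset.sum_congr rfl fun k _ => ?_
        rw [← Quaternion.coe_pow, Quaternion.mul_coe_eq_smul, map_smul, smul_eq_mul, mul_comm]
      by_cases hn : n < p.natDegree + 1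
      · have h2 : q.coeff n = 0 := by rw [hq, Polynomial.coeff_zero]
        simpa [q, Polynomial.finsetSum_coeff, Polynomial.coeff_monomial, hn] using h2
      · rw [Polynomial.coeff_eq_zero_of_natDegree_lt (by omega), map_zero]
    have key : ∀ x : ℝ, (p.eval (x : ℍ)).imI = 0 ∧ (p.eval (x : ℍ)).imJ = 0 ∧
        (p.eval (x : ℍ)).imK = 0 := by
      intro x
      have hu : ∃ i j : ℍ, i * i = -1 ∧ j * j = -1 ∧ i.imJ = 0 ∧ i.imK = 0 ∧ j.imI = 0 := by
        let i : ℍ := ⟨0, 1, 0, 0⟩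
        let j : ℍ := ⟨0, 0, 1, 0⟩
        refine ⟨i, j, ?_, ?_, rfl, rfl, rfl⟩ <;> ext <;>
          simp only [Quaternion.re_mul, Quaternion.imI_mul, Quaternion.imJ_mul,
            Quaternion.imK_mul] <;> simp [i, j]
      obtain ⟨i, j, hi, hj, hiJ, hiK, hjI⟩ := hu
      obtain ⟨a, b, hab⟩ := h i hi x 0
      obtain ⟨c, d, hcd⟩ := h j hj x 0
      rw [zero_smul, add_zero] at hab hcd
      refine ⟨?_, ?_, ?_⟩
      · rw [hcd]; simp [hjI]
      · rw [hab]; simp [hiJ]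
      · rw [hab]; simp [hiK]
    let fI : ℍ →ₗ[ℝ] ℝ := { toFun := fun a => a.imI, map_add' := by simp, map_smul' := by simp }
    let fJ : ℍ →ₗ[ℝ] ℝ := { toFun := fun a => a.imJ, map_add' := by simp, map_smul' := by simp }
    let fK : ℍ →ₗ[ℝ] ℝ := { toFun := fun a => a.imK, map_add' := by simp, map_smul' := by simp }
    have hI := comp fI fun x => (key x).1
    have hJ := comp fJ fun x => (key x).2.1
    have hK := comp fK fun x => (key x).2.2
    refine ⟨∑ k ∈ Finset.range (p.natDegree + 1), Polynomial.monomial k (p.coeff k).re, ?_⟩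
    ext1 n
    rw [Polynomial.coeff_map, Polynomial.finsetSum_coeff]
    simp only [Polynomial.coeff_monomial, Finset.sum_ite_eq', Finset.mem_range]
    split_ifs with hn
    · have h1 : (p.coeff n).imI = 0 := hI n
      have h2 : (p.coeff n).imJ = 0 := hJ n
      have h3 : (p.coeff n).imK = 0 := hK n
      ext <;> simp [Quaternion.algebraMap_def, h1, h2, h3]
    · rw [Polynomial.coeff_eq_zero_of_natDegree_lt (by omega), map_zero]
  · rintro ⟨p₀, rfl⟩ i hi u v
    rw [Polynomial.eval_map_algebraMap]
    induction p₀ using Polynomial.induction_on' with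
    | add p q hp hq =>
      obtain ⟨a, b, h⟩ := hp
      obtain ⟨c, d, h'⟩ := hq
      exact ⟨a + c, b + d, by rw [map_add, h, h', Quaternion.coe_add, add_smul]; abel⟩
    | monomial n r =>
      rw [Polynomial.aeval_monomial, Quaternion.algebraMap_def]
      suffices h : ∃ a b : ℝ, ((u : ℍ) + v • i) ^ n = (a : ℍ) + b • i by
        obtain ⟨a, b, h⟩ := h
        exact ⟨r * a, r * b, by
          rw [h, mul_add, Quaternion.coe_mul, Quaternion.coe_mul_eq_smul r (b • i), smul_smul]⟩
      induction n with
      | zero => exact ⟨1, 0, by simp⟩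
      | succ n ih =>
        obtain ⟨a, b, h⟩ := ih
        refine ⟨a * u - b * v, a * v + b * u, ?_⟩
        rw [pow_succ, h, add_mul, mul_add, mul_add, smul_mul_smul_comm, hi,
          Quaternion.mul_coe_eq_smul, Quaternion.mul_coe_eq_smul, Quaternion.coe_mul_eq_smul,
          smul_smul, smul_smul, Quaternion.coe_sub, Quaternion.coe_mul, Quaternion.coe_mul,
          Quaternion.mul_coe_eq_smul, Quaternion.mul_coe_eq_smul, add_smul, mul_comm u b, smul_neg]
        rw [show (b * v) • (1 : ℍ) = v • (b : ℍ) by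
          ext <;> simp [mul_comm]]
        abel

/-- The quaternionic poles of an intrinsic rational function: the zeros of its denominator in lowest
terms. -/
def poleSet (R : RatFunc ℝ) : Set ℍ :=
  {q | Polynomial.aeval q R.denom = 0}

open Classical in
/-- `R` as a map of `ℍ ∪ {∞}` to itself. A pole is mapped to `∞`, and
`R(∞)` is the limit of `R(q)` as `|q| → ∞`, i.e. `∞` if the numerator has the larger degree, and
otherwise the coefficient of `q ^ m` in the numerator, where `q ^ m` is the leading term of the
(monic) denominator. -/
noncomputable def ratExt (R : RatFunc ℝ) : OnePoint ℍ → OnePoint ℍ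
  | some q =>
    if q ∈ poleSet R then OnePoint.infty
    else ((Polynomial.aeval q R.num * (Polynomial.aeval q R.denom)⁻¹ : ℍ) : OnePoint ℍ)
  | none =>
    if R.denom.natDegree < R.num.natDegree then OnePoint.infty
    else (((R.num.coeff R.denom.natDegree : ℝ) : ℍ) : OnePoint ℍ)

/-! ### The rational functional calculus

Since the S-spectrum contains no poles of `R = P / Q`, the operator `Q(T)` has a bounded inverse,
and every vector is `v = Q(T)z` for a unique `z`. Then `R(T)v = P(T)z`, so that the products and
sums in question differ only in the powers of `T` to whose domains `z` has to belong. A polynomial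
`P(T)` is closed because, if `B` is the inverse of some `N(T)` with `deg N ≥ deg P`, its graph is
`{(v, w) | B w = P(T) B v}`. For the spectral inclusion, the numerator of `R² - 2 Re(t) R + |t|²`
vanishes at `s` if `t = R(s)`, so it is divisible by the minimal polynomial of `s` over `ℝ`; hence
`t ∈ ρ_S(R(T))` makes that polynomial of `T`, and its square, boundedly invertible. -/

section PowDomain

open Polynomial

variable {K V : Type*} [Field K] [AddCommGroup V] [Module K V]

/-- The domain of the `n`-th power of the operator that is given by `τ` on the domain `D`. The map
`τ` is defined on the whole space, so that `aeval τ P` makes sense; its values outside `D` are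
irrelevant. -/
def powDomain (D : Submodule K V) (τ : Module.End K V) (n : ℕ) : Submodule K V :=
  ⨅ k < n, D.comap (τ ^ k)

variable {D : Submodule K V} {τ : Module.End K V} {m n : ℕ} {v : V} {P : K[X]}

theorem mem_powDomain : v ∈ powDomain D τ n ↔ ∀ k < n, (τ ^ k) v ∈ D := by
  simp only [powDomain, Submodule.mem_iInf, Submodule.mem_comap]

theorem powDomain_zero : powDomain D τ 0 = ⊤ := by simp [powDomain]

theorem powDomain_one : powDomain D τ 1 = D := by ext; simp [mem_powDomain]

theorem powDomain_anti (h : m ≤ n) : powDomain D τ n ≤ powDomain D τ m := fun _ hv =>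
  mem_powDomain.2 fun k hk => mem_powDomain.1 hv k (hk.trans_le h)

theorem mem_powDomain_succ :
    v ∈ powDomain D τ (n + 1) ↔ v ∈ powDomain D τ n ∧ (τ ^ n) v ∈ D := by
  simp only [mem_powDomain, Nat.lt_succ_iff_lt_or_eq, or_imp, forall_and, forall_eq]

theorem pow_mem_powDomain (hv : v ∈ powDomain D τ (m + n)) : (τ ^ m) v ∈ powDomain D τ n := by
  refine mem_powDomain.2 fun k hk => ?_
  rw [← Module.End.mul_apply, ← pow_add]
  exact mem_powDomain.1 hv _ (by lia)

theorem aeval_mem_powDomain (hv : v ∈ powDomain D τ m) (hm : P.natDegree + n ≤ m) :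
    aeval τ P v ∈ powDomain D τ n := by
  rw [aeval_eq_sum_range, LinearMap.sum_apply]
  refine Submodule.sum_mem _ fun i hi => Submodule.smul_mem _ _ (pow_mem_powDomain ?_)
  exact powDomain_anti (by grind) hv

theorem aeval_mul_apply (P Q : K[X]) (v : V) : aeval τ (P * Q) v = aeval τ P (aeval τ Q v) := by
  rw [map_mul, Module.End.mul_apply]

theorem aeval_aeval_comm (P Q : K[X]) (v : V) :
    aeval τ P (aeval τ Q v) = aeval τ Q (aeval τ P v) := by
  rw [← aeval_mul_apply, mul_comm, aeval_mul_apply]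

theorem aeval_sub_leadingCoeff_smul_mem (hv : v ∈ powDomain D τ P.natDegree) :
    aeval τ P v - P.leadingCoeff • (τ ^ P.natDegree) v ∈ D := by
  rw [aeval_eq_sum_range, Finset.sum_range_succ, LinearMap.add_apply, LinearMap.smul_apply,
    coeff_natDegree, add_sub_cancel_right, LinearMap.sum_apply]
  exact Submodule.sum_mem _ fun i hi =>
    D.smul_mem _ (mem_powDomain.1 hv i (Finset.mem_range.1 hi))

theorem aeval_mem_powDomain_iff (hP : P ≠ 0) (hv : v ∈ powDomain D τ P.natDegree) :
    aeval τ P v ∈ powDomain D τ n ↔ v ∈ powDomain D τ (P.natDegree + n) := by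
  refine ⟨fun h => ?_, fun h => aeval_mem_powDomain h le_rfl⟩
  induction n with
  | zero => exact hv
  | succ n ih =>
    obtain ⟨hn, hD⟩ := mem_powDomain_succ.1 h
    have hv' := ih hn
    have hlead : (X ^ n * P).leadingCoeff ≠ 0 := by simpa using hP
    have hdeg : (X ^ n * P).natDegree = P.natDegree + n := by
      rw [natDegree_mul (pow_ne_zero n X_ne_zero) hP, natDegree_X_pow, add_comm]
    have hlower := aeval_sub_leadingCoeff_smul_mem (P := X ^ n * P) (hdeg ▸ hv')
    rw [aeval_mul_apply, aeval_X_pow, D.sub_mem_iff_right hD, D.smul_mem_iff hlead, hdeg] at hlower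
    exact mem_powDomain_succ.2 ⟨hv', hlower⟩

end PowDomain

section BoundedInverse

open Polynomial

variable {𝕜 V : Type*} [NontriviallyNormedField 𝕜] [NormedAddCommGroup V] [NormedSpace 𝕜 V]

/-- `B` is an everywhere defined bounded inverse of the operator that is given by `f` on the domain
`S`. -/
structure IsBoundedInverse (S : Submodule 𝕜 V) (f : Module.End 𝕜 V) (B : V →L[𝕜] V) : Prop where
  mem : ∀ w, B w ∈ S
  apply_inverse : ∀ w, f (B w) = w
  inverse_apply : ∀ v ∈ S, B (f v) = v

theorem IsBoundedInverse.injOn {S : Submodule 𝕜 V} {f : Module.End 𝕜 V} {B : V →L[𝕜] V}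
    (h : IsBoundedInverse S f B) : Set.InjOn f S :=
  Set.LeftInvOn.injOn h.inverse_apply

/-- `P(T)` has an everywhere defined bounded inverse, where `T` is the operator that is given by `τ`
on the domain `D`. The zero polynomial is excluded to avoid exceptions when `V` is trivial. -/
def BoundedlyInvertible (D : Submodule 𝕜 V) (τ : Module.End 𝕜 V) (P : 𝕜[X]) : Prop :=
  P ≠ 0 ∧ ∃ B, IsBoundedInverse (powDomain D τ P.natDegree) (aeval τ P) B

variable {D : Submodule 𝕜 V} {τ : Module.End 𝕜 V} {P Q : 𝕜[X]}

theorem BoundedlyInvertible.exists_aeval_eq (hP : BoundedlyInvertible D τ P) (v : V) :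
    ∃ z ∈ powDomain D τ P.natDegree, aeval τ P z = v :=
  let ⟨_, B, hB⟩ := hP
  ⟨B v, hB.mem v, hB.apply_inverse v⟩

theorem BoundedlyInvertible.mul (hP : BoundedlyInvertible D τ P)
    (hQ : BoundedlyInvertible D τ Q) : BoundedlyInvertible D τ (P * Q) := by
  obtain ⟨hP₀, B, hB⟩ := hP
  obtain ⟨hQ₀, C, hC⟩ := hQ
  refine ⟨mul_ne_zero hP₀ hQ₀, C ∘L B, ?_⟩
  rw [natDegree_mul hP₀ hQ₀, add_comm]
  refine ⟨fun w => ?_, fun w => ?_, fun v hv => ?_⟩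
  · rw [ContinuousLinearMap.comp_apply, ← aeval_mem_powDomain_iff hQ₀ (hC.mem _),
      hC.apply_inverse]
    exact hB.mem w
  · rw [aeval_mul_apply, ContinuousLinearMap.comp_apply, hC.apply_inverse, hB.apply_inverse]
  · rw [aeval_mul_apply, ContinuousLinearMap.comp_apply,
      hB.inverse_apply _ (aeval_mem_powDomain hv le_rfl),
      hC.inverse_apply _ (powDomain_anti (Nat.le_add_right _ _) hv)]

theorem BoundedlyInvertible.of_isUnit (hP : IsUnit P) : BoundedlyInvertible D τ P := by
  obtain ⟨c, hc, rfl⟩ := isUnit_iff.1 hP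
  refine ⟨hP.ne_zero, c⁻¹ • .id 𝕜 V, ?_⟩
  rw [natDegree_C, powDomain_zero]
  constructor <;> simp [hc.ne_zero]

theorem BoundedlyInvertible.pow (hP : BoundedlyInvertible D τ P) (n : ℕ) :
    BoundedlyInvertible D τ (P ^ n) := by
  induction n with
  | zero => exact .of_isUnit (by rw [pow_zero]; exact isUnit_one)
  | succ n ih => exact pow_succ P n ▸ ih.mul hP

variable [CompleteSpace V]

/-- Applied repeatedly, the closed graph theorem shows that each `τ ^ k ∘ B` is bounded. -/
theorem continuous_pow_comp (hτ : IsClosed (Set.graphOn τ D)) {B : V →L[𝕜] V} {n k : ℕ}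
    (hB : ∀ v, B v ∈ powDomain D τ n) (hk : k ≤ n) : Continuous fun v => (τ ^ k) (B v) := by
  induction k with
  | zero => exact B.continuous
  | succ k ih =>
    have hcont := ih (Nat.le_of_succ_le hk)
    refine LinearMap.continuous_of_isClosed_graph ((τ ^ (k + 1)) ∘ₗ (B : V →ₗ[𝕜] V)) ?_
    convert hτ.preimage (hcont.prodMap continuous_id)
    ext ⟨v, w⟩
    have hD : (τ ^ k) (B v) ∈ D := mem_powDomain.1 (hB v) k hk
    simp [LinearMap.mem_graph_iff, pow_succ', hD, eq_comm]

theorem continuous_aeval_comp (hτ : IsClosed (Set.graphOn τ D)) {B : V →L[𝕜] V} {n : ℕ}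
    (hB : ∀ v, B v ∈ powDomain D τ n) (hP : P.natDegree ≤ n) :
    Continuous fun v => aeval τ P (B v) := by
  simp only [aeval_eq_sum_range, LinearMap.sum_apply, LinearMap.smul_apply]
  exact continuous_finsetSum _ fun k hk =>
    (continuous_pow_comp hτ hB (by grind)).const_smul _

/-- If `B` is the inverse of `N(T)`, then `P(T)v = w` if and only if `Bw = P(T)Bv`: the right-hand
side forces `Bv` to lie in the domain of `T ^ (deg N + deg P)`. -/
theorem isClosed_graphOn_aeval_of_natDegree_le (hτ : IsClosed (Set.graphOn τ D)) {N : 𝕜[X]}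
    (hN : BoundedlyInvertible D τ N) (hP : P.natDegree ≤ N.natDegree) :
    IsClosed (Set.graphOn (aeval τ P) (powDomain D τ P.natDegree)) := by
  obtain ⟨hN₀, B, hB⟩ := hN
  have hPB := continuous_aeval_comp hτ hB.mem hP
  convert isClosed_eq (B.continuous.comp continuous_snd) (hPB.comp continuous_fst)
  ext ⟨v, w⟩
  have hv : aeval τ N (aeval τ P (B v)) = aeval τ P v := by
    rw [aeval_aeval_comm, hB.apply_inverse]
  simp only [Set.mem_graphOn, SetLike.mem_coe, Set.mem_ofPred_eq, Function.comp_apply]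
  constructor
  · rintro ⟨hvP, rfl⟩
    have hBv : B v ∈ powDomain D τ (N.natDegree + P.natDegree) := by
      rwa [← aeval_mem_powDomain_iff hN₀ (hB.mem v), hB.apply_inverse]
    rw [← hv, hB.inverse_apply _ (aeval_mem_powDomain hBv (add_comm _ _).le)]
  · intro h
    refine ⟨?_, by rw [← hv, ← h, hB.apply_inverse]⟩
    rcases eq_or_ne P 0 with rfl | hP₀
    · simp [powDomain_zero]
    have hPBv : aeval τ P (B v) ∈ powDomain D τ N.natDegree := h ▸ hB.mem w
    rw [aeval_mem_powDomain_iff hP₀ (powDomain_anti hP (hB.mem v))] at hPBv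
    rw [← hB.apply_inverse v]
    exact aeval_mem_powDomain hPBv (add_comm _ _).le

theorem isClosed_graphOn_aeval (hτ : IsClosed (Set.graphOn τ D)) {N : 𝕜[X]}
    (hN : BoundedlyInvertible D τ N) (hN₁ : 0 < N.natDegree) (P : 𝕜[X]) :
    IsClosed (Set.graphOn (aeval τ P) (powDomain D τ P.natDegree)) :=
  isClosed_graphOn_aeval_of_natDegree_le hτ (hN.pow P.natDegree)
    (by rw [natDegree_pow]; exact Nat.le_mul_of_pos_right _ hN₁)

/-- The domain `powDomain D τ n` may be smaller than the natural domain of `N(T)`. -/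
theorem IsBoundedInverse.boundedlyInvertible_of_dvd (hτ : IsClosed (Set.graphOn τ D))
    {N m : 𝕜[X]} {n : ℕ} {B : V →L[𝕜] V}
    (hB : IsBoundedInverse (powDomain D τ n) (aeval τ N) B) (hn : N.natDegree ≤ n)
    (hm : m ≠ 0) (hdvd : m ∣ N) : BoundedlyInvertible D τ m := by
  obtain ⟨k, rfl⟩ := hdvd
  have hk : k.natDegree ≤ n := by
    rcases eq_or_ne k 0 with rfl | hk
    · simp
    · rw [natDegree_mul hm hk] at hn; lia
  let C : V →L[𝕜] V :=
    ⟨aeval τ k ∘ₗ (B : V →ₗ[𝕜] V), continuous_aeval_comp hτ hB.mem hk⟩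
  have hC (w : V) : aeval τ m (C w) = w := (aeval_mul_apply m k _).symm.trans (hB.apply_inverse w)
  have hmem (w : V) : C w ∈ powDomain D τ m.natDegree := by
    rcases eq_or_ne k 0 with rfl | hk₀
    · simp [C]
    · rw [natDegree_mul hm hk₀] at hn
      exact aeval_mem_powDomain (hB.mem w) (by lia)
  -- A vector in the kernel of `m(T)` lies in the domains of all powers of `T`.
  have hker {v : V} (hv : v ∈ powDomain D τ m.natDegree) (h : aeval τ m v = 0) : v = 0 := by
    have hvn : v ∈ powDomain D τ (m.natDegree + n) :=
      (aeval_mem_powDomain_iff hm hv).1 (h ▸ Submodule.zero_mem _)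
    rw [← hB.inverse_apply v (powDomain_anti (Nat.le_add_left _ _) hvn), mul_comm,
      aeval_mul_apply, h, map_zero, map_zero]
  refine ⟨hm, C, hmem, hC, fun v hv => ?_⟩
  exact sub_eq_zero.1 (hker (sub_mem (hmem _) hv) (by rw [map_sub, hC, sub_self]))

theorem BoundedlyInvertible.of_dvd (hP : BoundedlyInvertible D τ P)
    (hτ : IsClosed (Set.graphOn τ D)) (hdvd : Q ∣ P) : BoundedlyInvertible D τ Q := by
  obtain ⟨hP₀, B, hB⟩ := hP
  exact hB.boundedlyInvertible_of_dvd hτ le_rfl (ne_zero_of_dvd_ne_zero hP₀ hdvd) hdvd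

end BoundedInverse

section Sphere

open Polynomial

/-- The real polynomial `X² - 2 Re(s) X + |s|²`, whose zeros in `ℍ` are the conjugates of `s`. -/
noncomputable def sPoly (s : ℍ) : ℝ[X] := X ^ 2 + C (-(2 * s.re)) * X + C (‖s‖ ^ 2)

theorem natDegree_sPoly (s : ℍ) : (sPoly s).natDegree = 2 := by
  unfold sPoly; compute_degree!

theorem monic_sPoly (s : ℍ) : (sPoly s).Monic := by
  unfold sPoly; monicity!

theorem aeval_sPoly {A : Type*} [Ring A] [Algebra ℝ A] (s : ℍ) (a : A) :
    aeval a (sPoly s) = a ^ 2 + (-(2 * s.re)) • a + (‖s‖ ^ 2) • (1 : A) := by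
  simp only [sPoly, map_add, map_mul, aeval_X_pow, aeval_X, aeval_C, Algebra.algebraMap_eq_smul_one,
    smul_mul_assoc, one_mul]

theorem aeval_sPoly_self (s : ℍ) : aeval s (sPoly s) = 0 := by
  rw [aeval_sPoly, sq ‖s‖, ← Quaternion.normSq_eq_norm_mul_self, Quaternion.normSq_def', sq]
  ext <;> simp <;> ring

theorem sPoly_coe (a : ℝ) : sPoly (a : ℍ) = (X - C a) ^ 2 := by
  simp only [sPoly, Quaternion.re_coe, Quaternion.norm_coe, Real.norm_eq_abs, sq_abs, map_neg,
    map_mul, map_pow, C_ofNat]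
  ring

theorem isIntegral_quaternion (s : ℍ) : IsIntegral ℝ s :=
  ⟨sPoly s, monic_sPoly s, by rw [← aeval_def, aeval_sPoly_self]⟩

theorem sPoly_dvd_minpoly_sq (s : ℍ) : sPoly s ∣ minpoly ℝ s ^ 2 := by
  by_cases hs : s ∈ (algebraMap ℝ ℍ).range
  · obtain ⟨a, rfl⟩ := hs
    rw [minpoly.eq_X_sub_C, Quaternion.algebraMap_def, sPoly_coe]
  · have hdvd : minpoly ℝ s ∣ sPoly s := minpoly.dvd ℝ s (aeval_sPoly_self s)
    have hdeg := (minpoly.two_le_natDegree_iff (isIntegral_quaternion s)).2 hs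
    rw [← eq_of_monic_of_dvd_of_natDegree_le (minpoly.monic (isIntegral_quaternion s))
      (monic_sPoly s) hdvd (by rwa [natDegree_sPoly])]
    exact dvd_pow_self _ two_ne_zero

/-- The numerator of `R² - 2 Re(t) R + |t|²` for `R = P / Q`. -/
noncomputable def sNum (t : ℍ) (P Q : ℝ[X]) : ℝ[X] :=
  P ^ 2 + C (-(2 * t.re)) * (P * Q) + C (‖t‖ ^ 2) * Q ^ 2

theorem natDegree_sNum_le (t : ℍ) (P Q : ℝ[X]) :
    (sNum t P Q).natDegree ≤ 2 * max P.natDegree Q.natDegree := by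
  have hPQ := natDegree_mul_le (p := P) (q := Q)
  have hP := natDegree_pow_le (p := P) (n := 2)
  have hQ := natDegree_pow_le (p := Q) (n := 2)
  refine natDegree_add_le_of_degree_le (natDegree_add_le_of_degree_le ?_ ?_) ?_
  · lia
  · exact (natDegree_C_mul_le _ _).trans (by lia)
  · exact (natDegree_C_mul_le _ _).trans (by lia)

theorem aeval_sNum_of_eq_mul {s t : ℍ} {P Q : ℝ[X]} (h : aeval s P = t * aeval s Q) :
    aeval s (sNum t P Q) = 0 := by
  rcases eq_or_ne (aeval s Q) 0 with hQ | hQ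
  · simp [sNum, h, hQ]
  have hcomm : Commute t (aeval s Q) := by
    have hPQ : Commute (aeval s P) (aeval s Q) := (Commute.all P Q).map (aeval s)
    rw [(eq_mul_inv_iff_mul_eq₀ hQ).2 h.symm]
    exact hPQ.mul_left (Commute.refl _).inv_left₀
  calc aeval s (sNum t P Q) = aeval t (sPoly t) * aeval s Q ^ 2 := by
        simp only [sNum, aeval_sPoly, map_add, map_mul, map_pow, aeval_C, h, hcomm.mul_pow,
          Algebra.algebraMap_eq_smul_one, _root_.smul_pow, one_pow, smul_mul_assoc, one_mul,
          add_mul, sq (aeval s Q), mul_assoc]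
    _ = 0 := by rw [aeval_sPoly_self, zero_mul]

theorem sNum_coe (c : ℝ) (P Q : ℝ[X]) : sNum (c : ℍ) P Q = (P - C c * Q) ^ 2 := by
  simp only [sNum, Quaternion.re_coe, Quaternion.norm_coe, Real.norm_eq_abs, sq_abs, map_neg,
    map_mul, map_pow, C_ofNat]
  ring

variable {V : Type*} [NormedAddCommGroup V] [NormedSpace ℝ V] [CompleteSpace V]
  {D : Submodule ℝ V} {τ : Module.End ℝ V}

theorem BoundedlyInvertible.sPoly_of_aeval_eq_zero (hτ : IsClosed (Set.graphOn τ D)) {s : ℍ}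
    {N : ℝ[X]} (hN : aeval s N = 0) (h : ∀ m, m ≠ 0 → m ∣ N → BoundedlyInvertible D τ m) :
    BoundedlyInvertible D τ (sPoly s) :=
  ((h _ (minpoly.ne_zero (isIntegral_quaternion s)) (minpoly.dvd ℝ s hN)).pow 2).of_dvd hτ
    (sPoly_dvd_minpoly_sq s)

theorem BoundedlyInvertible.of_forall_sPoly (hτ : IsClosed (Set.graphOn τ D)) {Q : ℝ[X]}
    (hQ : Q ≠ 0) (h : ∀ s : ℍ, aeval s Q = 0 → BoundedlyInvertible D τ (sPoly s)) :
    BoundedlyInvertible D τ Q := by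
  induction Q using WfDvdMonoid.induction_on_irreducible with
  | zero => exact absurd rfl hQ
  | unit u hu => exact .of_isUnit hu
  | mul Q f hQ₀ hf ih =>
    refine .mul ?_ (ih hQ₀ fun s hs => h s (by rw [map_mul, hs, mul_zero]))
    obtain ⟨z, hz⟩ := IsAlgClosed.exists_aeval_eq_zero ℂ f (degree_pos_of_irreducible hf).ne'
    set s := Quaternion.ofComplex z
    have hs : aeval s f = 0 := by rw [aeval_algHom_apply, hz, map_zero]
    have hf_dvd : f ∣ minpoly ℝ s :=
      ((minpoly.irreducible (isIntegral_quaternion s)).associated_of_dvd hf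
        (minpoly.dvd ℝ s hs)).symm.dvd
    exact (h s (by rw [map_mul, hs, zero_mul])).of_dvd hτ
      (hf_dvd.trans (minpoly.dvd ℝ s (aeval_sPoly_self s)))

end Sphere

section Graph

open Polynomial

variable {A V : Type*} [Ring A] [NormedAddCommGroup V] [Module A V]

theorem mem_graph_opComp {g f : V →ₗ.[A] V} {v w : V} :
    (v, w) ∈ (opComp g f).graph ↔ ∃ u, (v, u) ∈ f.graph ∧ (u, w) ∈ g.graph := by
  simp only [LinearPMap.mem_graph_iff]
  constructor
  · rintro ⟨⟨x, hx⟩, rfl, rfl⟩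
    obtain ⟨h, h'⟩ := (mem_domain_opComp g f x).1 hx
    exact ⟨_, ⟨⟨x, h⟩, rfl, rfl⟩, ⟨_, h'⟩, rfl, (opComp_apply g f x hx h h').symm⟩
  · rintro ⟨_, ⟨⟨x, h⟩, rfl, rfl⟩, ⟨⟨_, h'⟩, rfl, rfl⟩⟩
    have hx := (mem_domain_opComp g f x).2 ⟨h, h'⟩
    exact ⟨⟨x, hx⟩, rfl, opComp_apply g f x hx h h'⟩

theorem mem_graph_add {g f : V →ₗ.[A] V} {v w : V} :
    (v, w) ∈ (g + f).graph ↔ ∃ x y, (v, x) ∈ g.graph ∧ (v, y) ∈ f.graph ∧ x + y = w := by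
  simp only [LinearPMap.mem_graph_iff]
  constructor
  · rintro ⟨⟨x, hx, hx'⟩, rfl, rfl⟩
    exact ⟨_, _, ⟨⟨x, hx⟩, rfl, rfl⟩, ⟨⟨x, hx'⟩, rfl, rfl⟩, rfl⟩
  · rintro ⟨_, _, ⟨⟨_, hv⟩, rfl, rfl⟩, ⟨⟨v, hv'⟩, rfl, rfl⟩, rfl⟩
    exact ⟨⟨v, hv, hv'⟩, rfl, rfl⟩

theorem mem_graph_toPMap_top {f : V →ₗ[A] V} {v w : V} :
    (v, w) ∈ (f.toPMap ⊤).graph ↔ f v = w := by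
  simp [LinearPMap.mem_graph_iff]

theorem hasBoundedInverse_iff_graph {L : V →ₗ.[A] V} :
    HasBoundedInverse L ↔ ∃ B : V →L[A] V, ∀ v w, (v, w) ∈ L.graph ↔ B w = v := by
  simp only [LinearPMap.mem_graph_iff]
  constructor
  · rintro ⟨B, hBL, hLB⟩
    refine ⟨B, fun v w => ⟨?_, ?_⟩⟩
    · rintro ⟨x, rfl, rfl⟩
      exact hBL x
    · rintro rfl
      obtain ⟨hw, hw'⟩ := hLB w
      exact ⟨⟨_, hw⟩, rfl, hw'⟩
  · rintro ⟨B, hB⟩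
    refine ⟨B, fun v => (hB _ _).1 ⟨v, rfl, rfl⟩, fun w => ?_⟩
    obtain ⟨⟨x, hx⟩, hxB, hxw⟩ := (hB (B w) w).2 rfl
    obtain rfl : x = B w := hxB
    exact ⟨hx, hxw⟩

variable [NormedSpace ℝ V]

/-- The operator `f` is the restriction of the real linear map `σ` to the domain `S`. -/
def IsRestriction (f : V →ₗ.[A] V) (S : Submodule ℝ V) (σ : Module.End ℝ V) : Prop :=
  (f.graph : Set (V × V)) = Set.graphOn σ S

namespace IsRestriction

variable {f T : V →ₗ.[A] V} {S D : Submodule ℝ V} {σ τ : Module.End ℝ V}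

theorem mem_graph_iff (h : IsRestriction f S σ) {v w : V} :
    (v, w) ∈ f.graph ↔ v ∈ S ∧ σ v = w := by
  rw [← SetLike.mem_coe, h, Set.mem_graphOn, SetLike.mem_coe]

theorem of_mem_graph_iff (h : ∀ v w, (v, w) ∈ f.graph ↔ v ∈ S ∧ σ v = w) : IsRestriction f S σ :=
  Set.ext fun x => (h x.1 x.2).trans Set.mem_graphOn.symm

theorem isClosedOp_iff (h : IsRestriction f S σ) : IsClosedOp f ↔ IsClosed (Set.graphOn σ S) := by
  rw [← h]; rfl

theorem isBoundedOp [CompleteSpace V] (h : IsRestriction T D τ) (hT : IsClosedOp T)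
    (hD : ∀ v, v ∈ D) : IsBoundedOp T := by
  have hdom (v : V) : v ∈ T.domain :=
    LinearPMap.mem_domain_of_mem_graph (h.mem_graph_iff.2 ⟨hD v, rfl⟩)
  let B : V →ₗ[A] V := T.toFun ∘ₗ LinearMap.id.codRestrict T.domain hdom
  have hB : T = B.toPMap ⊤ :=
    LinearPMap.ext (by ext v; simp [hdom v]) fun _ _ _ => rfl
  have hBτ (v : V) : τ v = B v := (h.mem_graph_iff.1 (hB ▸ mem_graph_toPMap_top.2 rfl)).2
  have hcont : Continuous B := by
    refine (LinearMap.continuous_of_isClosed_graph τ ?_).congr hBτ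
    convert h.isClosedOp_iff.1 hT
    ext ⟨v, w⟩
    simp [LinearMap.mem_graph_iff, hD, eq_comm]
  exact ⟨⟨B, hcont⟩, hB⟩

theorem mem_graph_inverse (h : IsRestriction f S σ) (hσ : Set.InjOn σ S) {v w : V} :
    (v, w) ∈ f.inverse.graph ↔ w ∈ S ∧ σ w = v := by
  have hker : LinearMap.ker f.toFun = ⊥ := by
    refine LinearMap.ker_eq_bot'.2 fun x hx => ?_
    obtain ⟨hxS, hσx⟩ := h.mem_graph_iff.1 (f.mem_graph x)
    exact Subtype.ext (hσ hxS S.zero_mem (hσx.trans (hx.trans (map_zero σ).symm)))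
  rw [LinearPMap.inverse_graph hker, ← h.mem_graph_iff]
  simp

theorem opPow (h : IsRestriction T D τ) (n : ℕ) :
    IsRestriction (opPow T n) (powDomain D τ n) (τ ^ n) := by
  refine of_mem_graph_iff fun v w => ?_
  induction n generalizing w with
  | zero => simp [_root_.opPow, powDomain_zero]
  | succ n ih =>
    rw [_root_.opPow, mem_graph_opComp, mem_powDomain_succ, pow_succ', Module.End.mul_apply]
    simp only [ih, h.mem_graph_iff]
    aesop

end IsRestriction

variable [Algebra ℝ A] [IsScalarTower ℝ A V]

theorem mem_graph_smul {c : ℝ} {f : V →ₗ.[A] V} {v w : V} :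
    (v, w) ∈ (c • f).graph ↔ ∃ u, (v, u) ∈ f.graph ∧ c • u = w := by
  simp only [LinearPMap.mem_graph_iff]
  constructor
  · rintro ⟨⟨x, hx⟩, rfl, rfl⟩
    exact ⟨_, ⟨⟨x, hx⟩, rfl, rfl⟩, rfl⟩
  · rintro ⟨_, ⟨⟨x, hx⟩, rfl, rfl⟩, rfl⟩
    exact ⟨⟨x, hx⟩, rfl, rfl⟩

theorem mem_graph_sOp {T : V →ₗ.[A] V} {s : ℍ} {v w : V} :
    (v, w) ∈ (sOp T s).graph ↔ ∃ u x, (v, u) ∈ T.graph ∧ (u, x) ∈ T.graph ∧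
      x + (-(2 * s.re)) • u + (‖s‖ ^ 2) • v = w := by
  simp only [sOp, opPow, mem_graph_add, mem_graph_smul, mem_graph_opComp, mem_graph_toPMap_top,
    LinearMap.id_apply]
  constructor
  · rintro ⟨_, _, ⟨x, _, ⟨u, ⟨_, rfl, hu⟩, hx⟩, ⟨u', hu', rfl⟩, rfl⟩, ⟨_, rfl, rfl⟩, rfl⟩
    obtain rfl := T.mem_graph_snd_inj hu hu' rfl
    exact ⟨u, x, hu, hx, rfl⟩
  · rintro ⟨u, x, hu, hx, rfl⟩
    exact ⟨_, _, ⟨x, _, ⟨u, ⟨v, rfl, hu⟩, hx⟩, ⟨u, hu, rfl⟩, rfl⟩, ⟨v, rfl, rfl⟩, rfl⟩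

theorem exists_isRestriction (T : V →ₗ.[A] V) : ∃ D τ, IsRestriction T D τ := by
  obtain ⟨τ, hτ⟩ := LinearMap.exists_extend (p := T.domain.restrictScalars ℝ)
    (T.toFun.restrictScalars ℝ)
  have hτT (v : T.domain) : τ v = T v := LinearMap.congr_fun hτ v
  refine ⟨T.domain.restrictScalars ℝ, τ, .of_mem_graph_iff fun v w => ?_⟩
  rw [LinearPMap.mem_graph_iff]
  constructor
  · rintro ⟨x, rfl, rfl⟩
    exact ⟨x.2, hτT x⟩
  · rintro ⟨hv, rfl⟩
    exact ⟨⟨v, hv⟩, rfl, (hτT ⟨v, hv⟩).symm⟩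

namespace IsRestriction

variable {f T : V →ₗ.[A] V} {S D : Submodule ℝ V} {σ τ : Module.End ℝ V}

theorem sum_opPow (h : IsRestriction T D τ) (c : ℕ → ℝ) (n : ℕ) :
    IsRestriction (∑ l ∈ Finset.range (n + 1), c l • _root_.opPow T l) (powDomain D τ n)
      (∑ l ∈ Finset.range (n + 1), c l • τ ^ l) := by
  have hterm (k : ℕ) (v w : V) : (v, w) ∈ (c k • _root_.opPow T k).graph ↔
      v ∈ powDomain D τ k ∧ c k • (τ ^ k) v = w := by
    simp only [mem_graph_smul, (h.opPow k).mem_graph_iff]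
    aesop
  refine of_mem_graph_iff fun v w => ?_
  induction n generalizing w with
  | zero => simp only [zero_add, Finset.sum_range_one, hterm, LinearMap.smul_apply]
  | succ n ih =>
    have hanti := @powDomain_anti _ _ _ _ _ D τ _ _ n.le_succ v
    rw [Finset.sum_range_succ, mem_graph_add, Finset.sum_range_succ _ (n + 1)]
    simp only [ih, hterm, LinearMap.add_apply, LinearMap.smul_apply]
    aesop

theorem polyOp (h : IsRestriction T D τ) (P : ℝ[X]) :
    IsRestriction (polyOp P T) (powDomain D τ P.natDegree) (aeval τ P) := by
  rw [aeval_eq_sum_range]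
  exact h.sum_opPow P.coeff P.natDegree

theorem sOp (h : IsRestriction T D τ) (s : ℍ) :
    IsRestriction (sOp T s) (powDomain D τ (sPoly s).natDegree) (aeval τ (sPoly s)) := by
  refine of_mem_graph_iff fun v w => ?_
  rw [mem_graph_sOp, aeval_sPoly, natDegree_sPoly, mem_powDomain_succ, powDomain_one, pow_one]
  simp only [h.mem_graph_iff, sq, LinearMap.add_apply, LinearMap.smul_apply,
    Module.End.mul_apply, Module.End.one_apply]
  aesop

theorem hasBoundedInverse_iff (h : IsRestriction f S σ) :
    HasBoundedInverse f ↔ ∃ B, IsBoundedInverse S σ B := by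
  simp only [hasBoundedInverse_iff_graph, h.mem_graph_iff]
  constructor
  · rintro ⟨B, hB⟩
    exact ⟨B.restrictScalars ℝ, fun w => ((hB _ w).2 rfl).1, fun w => ((hB _ w).2 rfl).2,
      fun v hv => (hB v _).1 ⟨hv, rfl⟩⟩
  · rintro ⟨B, hB⟩
    have hB' (v w : V) : v ∈ S ∧ σ v = w ↔ B w = v :=
      ⟨fun ⟨hv, hw⟩ => hw ▸ hB.inverse_apply v hv, fun hv => hv ▸ ⟨hB.mem w, hB.apply_inverse w⟩⟩
    have hgraph (w : V) : (B w, w) ∈ f.graph := h.mem_graph_iff.2 ((hB' _ w).2 rfl)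
    have hsmul (a : A) (w : V) : B (a • w) = a • B w :=
      (hB' _ _).1 (h.mem_graph_iff.1 (f.graph.smul_mem a (hgraph w)))
    exact ⟨⟨⟨B.toLinearMap.toAddHom, hsmul⟩, B.continuous⟩, hB'⟩

theorem mem_sResolventSet_iff (h : IsRestriction T D τ) {s : ℍ} :
    s ∈ sResolventSet T ↔ BoundedlyInvertible D τ (sPoly s) :=
  (h.sOp s).hasBoundedInverse_iff.trans (and_iff_right (monic_sPoly s).ne_zero).symm

end IsRestriction

end Graph

section RatFunc

open Polynomial

variable {K : Type*} [Field K] {R R₁ : RatFunc K} {P Q P₁ Q₁ : K[X]}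

theorem exists_eq_num_mul_denom_mul (hQ : Q ≠ 0)
    (hR : R = algebraMap K[X] (RatFunc K) P / algebraMap K[X] (RatFunc K) Q) :
    ∃ F ≠ 0, P = R.num * F ∧ Q = R.denom * F := by
  have hcross : R.num * Q = P * R.denom := hR ▸ (RatFunc.num_mul_eq_mul_denom_iff hQ).2 rfl
  obtain ⟨F, rfl⟩ : R.denom ∣ Q :=
    (RatFunc.isCoprime_num_denom R).symm.dvd_of_dvd_mul_left (hcross ▸ dvd_mul_left _ _)
  refine ⟨F, right_ne_zero_of_mul hQ, mul_right_cancel₀ R.denom_ne_zero ?_, rfl⟩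
  rw [← hcross, mul_assoc, mul_comm F]

theorem intDegree_algebraMap_div (hP : P ≠ 0) (hQ : Q ≠ 0) :
    (algebraMap K[X] (RatFunc K) P / algebraMap K[X] (RatFunc K) Q).intDegree =
      (P.natDegree : ℤ) - Q.natDegree := by
  rw [RatFunc.intDegree_div (RatFunc.algebraMap_ne_zero hP) (RatFunc.algebraMap_ne_zero hQ),
    RatFunc.intDegree_polynomial, RatFunc.intDegree_polynomial]

theorem algebraMap_div_add_div (hQ : Q ≠ 0) (hQ₁ : Q₁ ≠ 0) :
    algebraMap K[X] (RatFunc K) P / algebraMap K[X] (RatFunc K) Q +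
        algebraMap K[X] (RatFunc K) P₁ / algebraMap K[X] (RatFunc K) Q₁ =
      algebraMap K[X] (RatFunc K) (P * Q₁ + P₁ * Q) /
        algebraMap K[X] (RatFunc K) (Q * Q₁) := by
  rw [div_add_div _ _ (RatFunc.algebraMap_ne_zero hQ) (RatFunc.algebraMap_ne_zero hQ₁)]
  simp only [map_add, map_mul, mul_comm]

theorem mul_eq_num_mul_num_div (R R₁ : RatFunc K) :
    R * R₁ = algebraMap K[X] (RatFunc K) (R.num * R₁.num) /
      algebraMap K[X] (RatFunc K) (R.denom * R₁.denom) := by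
  rw [map_mul, map_mul, mul_div_mul_comm, R.num_div_denom, R₁.num_div_denom]

theorem add_eq_num_add_num_div (R R₁ : RatFunc K) :
    R + R₁ = algebraMap K[X] (RatFunc K) (R.num * R₁.denom + R₁.num * R.denom) /
      algebraMap K[X] (RatFunc K) (R.denom * R₁.denom) := by
  rw [← algebraMap_div_add_div R.denom_ne_zero R₁.denom_ne_zero, R.num_div_denom,
    R₁.num_div_denom]

theorem intDegree_mul_intDegree_nonneg (hQ : Q ≠ 0) (hQ₁ : Q₁ ≠ 0)
    (hR : R = algebraMap K[X] (RatFunc K) P / algebraMap K[X] (RatFunc K) Q)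
    (hR₁ : R₁ = algebraMap K[X] (RatFunc K) P₁ / algebraMap K[X] (RatFunc K) Q₁)
    (h : 0 ≤ ((P.natDegree : ℤ) - Q.natDegree) * ((P₁.natDegree : ℤ) - Q₁.natDegree)) :
    0 ≤ R.intDegree * R₁.intDegree := by
  subst hR hR₁
  rcases eq_or_ne P 0 with rfl | hP
  · simp
  rcases eq_or_ne P₁ 0 with rfl | hP₁
  · simp
  rwa [intDegree_algebraMap_div hP hQ, intDegree_algebraMap_div hP₁ hQ₁]

theorem max_intDegree_le (hQ : Q ≠ 0) (hQ₁ : Q₁ ≠ 0)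
    (hR : R = algebraMap K[X] (RatFunc K) P / algebraMap K[X] (RatFunc K) Q)
    (hR₁ : R₁ = algebraMap K[X] (RatFunc K) P₁ / algebraMap K[X] (RatFunc K) Q₁)
    (h : (P * Q₁ + P₁ * Q).natDegree = max (P * Q₁).natDegree (P₁ * Q).natDegree) :
    max R.intDegree R₁.intDegree ≤ max 0 (R + R₁).intDegree := by
  have hle {P Q : K[X]} (hQ : Q ≠ 0) :
      (algebraMap K[X] (RatFunc K) P / algebraMap K[X] (RatFunc K) Q).intDegree ≤ 0 ∨
        P ≠ 0 ∧ (algebraMap K[X] (RatFunc K) P / algebraMap K[X] (RatFunc K) Q).intDegree =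
          (P.natDegree : ℤ) - Q.natDegree := by
    rcases eq_or_ne P 0 with rfl | hP
    · simp
    · exact .inr ⟨hP, intDegree_algebraMap_div hP hQ⟩
  have hsum : (P * Q₁ + P₁ * Q).natDegree = 0 ∨ (R + R₁).intDegree =
      ((P * Q₁ + P₁ * Q).natDegree : ℤ) - (Q.natDegree + Q₁.natDegree) := by
    rcases eq_or_ne (P * Q₁ + P₁ * Q) 0 with h₀ | h₀
    · simp [h₀]
    · right
      rw [hR, hR₁, algebraMap_div_add_div hQ hQ₁,
        intDegree_algebraMap_div h₀ (mul_ne_zero hQ hQ₁), natDegree_mul hQ hQ₁, Nat.cast_add]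
  rw [max_le_iff]
  constructor
  · rcases hle (P := P) hQ with hd | ⟨hP, hd⟩
    · exact hR ▸ hd.trans (le_max_left _ _)
    · rw [natDegree_mul hP hQ₁] at h
      rw [← hR] at hd
      lia
  · rcases hle (P := P₁) hQ₁ with hd | ⟨hP₁, hd⟩
    · exact hR₁ ▸ hd.trans (le_max_left _ _)
    · rw [natDegree_mul hP₁ hQ] at h
      rw [← hR₁] at hd
      lia

end RatFunc

section RationalCalculus

open Polynomial

variable {A V : Type*} [Ring A] [NormedAddCommGroup V] [Module A V] [Algebra ℝ A]
  [NormedSpace ℝ V] [IsScalarTower ℝ A V] [CompleteSpace V] {T : V →ₗ.[A] V}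
  {R R₁ : RatFunc ℝ}

namespace IsRestriction

variable {D : Submodule ℝ V} {τ : Module.End ℝ V} {P Q P₁ Q₁ : ℝ[X]} {z w : V}

theorem boundedlyInvertible_denom (h : IsRestriction T D τ) (hT : IsClosedOp T)
    (hR : Disjoint (poleSet R) (sSpectrum T)) : BoundedlyInvertible D τ R.denom :=
  .of_forall_sPoly (h.isClosedOp_iff.1 hT) R.denom_ne_zero fun _ hs =>
    h.mem_sResolventSet_iff.1 (Set.notMem_compl_iff.1 (Set.disjoint_left.1 hR hs))

/-- Every vector is of the form `Q(T)z`, and in terms of `z` the graph of `R(T)` is described by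
polynomials, whether or not `P / Q` is in lowest terms. -/
theorem mem_graph_ratOp (h : IsRestriction T D τ) (hT : IsClosedOp T)
    (hQ : BoundedlyInvertible D τ Q)
    (hR : R = algebraMap ℝ[X] (RatFunc ℝ) P / algebraMap ℝ[X] (RatFunc ℝ) Q)
    (hz : z ∈ powDomain D τ Q.natDegree) :
    (aeval τ Q z, w) ∈ (ratOp R T).graph ↔
      z ∈ powDomain D τ P.natDegree ∧ aeval τ P z = w := by
  obtain ⟨F, hF, rfl, rfl⟩ := exists_eq_num_mul_denom_mul hQ.1 hR
  obtain ⟨-, B, hB⟩ := hQ.of_dvd (h.isClosedOp_iff.1 hT) (Dvd.intro _ rfl)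
  rw [natDegree_mul R.denom_ne_zero hF, add_comm] at hz
  have hFz : aeval τ F z ∈ powDomain D τ R.denom.natDegree := aeval_mem_powDomain hz le_rfl
  have hnum : aeval τ F z ∈ powDomain D τ R.num.natDegree ↔
      z ∈ powDomain D τ (R.num * F).natDegree := by
    rcases eq_or_ne R.num 0 with h₀ | h₀
    · simp [h₀, powDomain_zero]
    · rw [aeval_mem_powDomain_iff hF (powDomain_anti (Nat.le_add_right _ _) hz),
        natDegree_mul h₀ hF, add_comm]
  have hdenom (u : V) : (u ∈ powDomain D τ R.denom.natDegree ∧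
      aeval τ R.denom u = aeval τ R.denom (aeval τ F z)) ↔ u = aeval τ F z :=
    ⟨fun hu => hB.injOn hu.1 hFz hu.2, by rintro rfl; exact ⟨hFz, rfl⟩⟩
  simp only [ratOp, mem_graph_opComp, (h.polyOp _).mem_graph_inverse hB.injOn, aeval_mul_apply,
    hdenom, (h.polyOp _).mem_graph_iff, exists_eq_left, hnum]

theorem mem_graph_opComp_ratOp (h : IsRestriction T D τ) (hT : IsClosedOp T)
    (hR : BoundedlyInvertible D τ R.denom) (hR₁ : BoundedlyInvertible D τ R₁.denom)
    (hz : z ∈ powDomain D τ (R.denom * R₁.denom).natDegree) :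
    (aeval τ (R.denom * R₁.denom) z, w) ∈ (opComp (ratOp R T) (ratOp R₁ T)).graph ↔
      z ∈ powDomain D τ (R.denom.natDegree + R₁.num.natDegree) ∧
        aeval τ R₁.num z ∈ powDomain D τ R.num.natDegree ∧ aeval τ (R.num * R₁.num) z = w := by
  rw [natDegree_mul hR.1 hR₁.1] at hz
  have hz' := powDomain_anti (Nat.le_add_right _ _) hz
  simp only [mem_graph_opComp, mul_comm R.denom, aeval_mul_apply,
    h.mem_graph_ratOp hT hR₁ R₁.num_div_denom.symm (aeval_mem_powDomain hz le_rfl),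
    aeval_mem_powDomain_iff hR.1 hz', and_assoc, exists_and_left, exists_eq_left']
  refine and_congr_right fun hzP => ?_
  rw [aeval_aeval_comm, h.mem_graph_ratOp hT hR R.num_div_denom.symm
    (aeval_mem_powDomain hzP (add_comm _ _).le)]

theorem mem_graph_add_ratOp (h : IsRestriction T D τ) (hT : IsClosedOp T)
    (hR : BoundedlyInvertible D τ R.denom) (hR₁ : BoundedlyInvertible D τ R₁.denom)
    (hz : z ∈ powDomain D τ (R.denom * R₁.denom).natDegree) :
    (aeval τ (R.denom * R₁.denom) z, w) ∈ (ratOp R T + ratOp R₁ T).graph ↔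
      z ∈ powDomain D τ (R₁.denom.natDegree + R.num.natDegree) ∧
        z ∈ powDomain D τ (R.denom.natDegree + R₁.num.natDegree) ∧
          aeval τ (R.num * R₁.denom + R₁.num * R.denom) z = w := by
  rw [natDegree_mul hR.1 hR₁.1] at hz
  have hz₁ := powDomain_anti (Nat.le_add_right _ _) hz
  have hz₂ := powDomain_anti (Nat.le_add_left _ _) hz
  have hgraph (x : V) : (aeval τ (R.denom * R₁.denom) z, x) ∈ (ratOp R T).graph ↔
      z ∈ powDomain D τ (R₁.denom.natDegree + R.num.natDegree) ∧
        aeval τ (R.num * R₁.denom) z = x := by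
    rw [aeval_mul_apply, h.mem_graph_ratOp hT hR R.num_div_denom.symm
      (aeval_mem_powDomain hz (add_comm _ _).le), aeval_mem_powDomain_iff hR₁.1 hz₂,
      aeval_mul_apply]
  have hgraph₁ (x : V) : (aeval τ (R.denom * R₁.denom) z, x) ∈ (ratOp R₁ T).graph ↔
      z ∈ powDomain D τ (R.denom.natDegree + R₁.num.natDegree) ∧
        aeval τ (R₁.num * R.denom) z = x := by
    rw [mul_comm, aeval_mul_apply, h.mem_graph_ratOp hT hR₁ R₁.num_div_denom.symm
      (aeval_mem_powDomain hz le_rfl), aeval_mem_powDomain_iff hR.1 hz₁, aeval_mul_apply]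
  simp only [mem_graph_add, hgraph, hgraph₁, map_add, LinearMap.add_apply]
  aesop

theorem mem_graph_sOp_ratOp (h : IsRestriction T D τ) (hT : IsClosedOp T)
    (hR : BoundedlyInvertible D τ R.denom) {t : ℍ}
    (hz : z ∈ powDomain D τ (R.denom ^ 2).natDegree) :
    (aeval τ (R.denom ^ 2) z, w) ∈ (_root_.sOp (ratOp R T) t).graph ↔
      z ∈ powDomain D τ (2 * max R.num.natDegree R.denom.natDegree) ∧
        aeval τ (sNum t R.num R.denom) z = w := by
  rw [natDegree_pow, two_mul] at hz
  have hzQ := powDomain_anti (Nat.le_add_right _ _) hz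
  have hfst (u : V) : (aeval τ (R.denom ^ 2) z, u) ∈ (ratOp R T).graph ↔
      z ∈ powDomain D τ (R.denom.natDegree + R.num.natDegree) ∧
        aeval τ R.denom (aeval τ R.num z) = u := by
    rw [sq, aeval_mul_apply, h.mem_graph_ratOp hT hR R.num_div_denom.symm
      (aeval_mem_powDomain hz le_rfl), aeval_mem_powDomain_iff hR.1 hzQ, aeval_aeval_comm]
  have hsnd (hzP : z ∈ powDomain D τ (R.denom.natDegree + R.num.natDegree)) (x : V) :
      (aeval τ R.denom (aeval τ R.num z), x) ∈ (ratOp R T).graph ↔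
        aeval τ R.num z ∈ powDomain D τ R.num.natDegree ∧ aeval τ (R.num ^ 2) z = x := by
    rw [h.mem_graph_ratOp hT hR R.num_div_denom.symm (aeval_mem_powDomain hzP (add_comm _ _).le),
      sq, aeval_mul_apply]
  have hdom : z ∈ powDomain D τ (R.denom.natDegree + R.num.natDegree) ∧
      aeval τ R.num z ∈ powDomain D τ R.num.natDegree ↔
        z ∈ powDomain D τ (2 * max R.num.natDegree R.denom.natDegree) := by
    rcases le_total R.num.natDegree R.denom.natDegree with hle | hle
    · rw [max_eq_right hle, two_mul]
      exact iff_of_true ⟨powDomain_anti (by lia) hz, aeval_mem_powDomain hz (by lia)⟩ hz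
    · rw [max_eq_left hle, two_mul]
      refine ⟨fun ⟨hzP, hP⟩ => ?_, fun hzP =>
        ⟨powDomain_anti (by lia) hzP, aeval_mem_powDomain hzP le_rfl⟩⟩
      rcases eq_or_ne R.num 0 with h₀ | h₀
      · simp [h₀, powDomain_zero]
      · exact (aeval_mem_powDomain_iff h₀ (powDomain_anti (Nat.le_add_left _ _) hzP)).1 hP
  have hval : aeval τ (sNum t R.num R.denom) z = aeval τ (R.num ^ 2) z +
      (-(2 * t.re)) • aeval τ R.denom (aeval τ R.num z) +
        (‖t‖ ^ 2) • aeval τ (R.denom ^ 2) z := by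
    simp only [sNum, mul_comm R.num, ← smul_eq_C_mul, map_add, map_smul, LinearMap.add_apply,
      LinearMap.smul_apply, aeval_mul_apply]
  simp only [mem_graph_sOp, hfst, ← hdom, hval]
  constructor
  · rintro ⟨_, x, ⟨hzP, rfl⟩, hx, rfl⟩
    obtain ⟨hP, rfl⟩ := (hsnd hzP x).1 hx
    exact ⟨⟨hzP, hP⟩, rfl⟩
  · rintro ⟨⟨hzP, hP⟩, rfl⟩
    exact ⟨_, _, ⟨hzP, rfl⟩, (hsnd hzP _).2 ⟨hP, rfl⟩, rfl⟩

/-- The product of the inverses of `R(T)² - 2 Re(t) R(T) + |t|²` and of `Q(T)²`. -/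
theorem exists_isBoundedInverse_sNum (h : IsRestriction T D τ) (hT : IsClosedOp T)
    (hR : BoundedlyInvertible D τ R.denom) {t : ℍ} (ht : t ∈ sResolventSet (ratOp R T)) :
    ∃ B, IsBoundedInverse (powDomain D τ (2 * max R.num.natDegree R.denom.natDegree))
      (aeval τ (sNum t R.num R.denom)) B := by
  obtain ⟨-, C, hC⟩ := hR.pow 2
  obtain ⟨B, hB⟩ := hasBoundedInverse_iff_graph.1 ht
  have hCB (w : V) := (h.mem_graph_sOp_ratOp hT hR (hC.mem (B w))).1
    ((hB _ w).2 (hC.apply_inverse (B w)).symm)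
  refine ⟨C ∘L B.restrictScalars ℝ, fun w => (hCB w).1, fun w => (hCB w).2, fun z hz => ?_⟩
  have hzQ : z ∈ powDomain D τ (R.denom ^ 2).natDegree :=
    powDomain_anti (by rw [natDegree_pow]; lia) hz
  have hBz := (hB _ _).1 ((h.mem_graph_sOp_ratOp hT hR hzQ).2 ⟨hz, rfl⟩)
  exact (congrArg C hBz).trans (hC.inverse_apply z hzQ)

end IsRestriction

theorem isClosedOp_ratOp (hT : IsClosedOp T) (hρ : (sResolventSet T).Nonempty)
    (hR : Disjoint (poleSet R) (sSpectrum T)) : IsClosedOp (ratOp R T) := by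
  obtain ⟨D, τ, h⟩ := exists_isRestriction T
  have hτ := h.isClosedOp_iff.1 hT
  have hQ := h.boundedlyInvertible_denom hT hR
  obtain ⟨B, hB⟩ := hQ.2
  obtain ⟨s, hs⟩ := hρ
  have hnum := isClosed_graphOn_aeval hτ (h.mem_sResolventSet_iff.1 hs)
    (by rw [natDegree_sPoly]; exact two_pos) R.num
  unfold IsClosedOp
  convert hnum.preimage (B.continuous.prodMap continuous_id)
  ext ⟨v, w⟩
  have hgraph := h.mem_graph_ratOp (w := w) hT hQ R.num_div_denom.symm (hB.mem v)
  rw [hB.apply_inverse] at hgraph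
  rw [Set.mem_preimage, Set.mem_graphOn]
  exact hgraph

theorem opComp_ratOp_le (hT : IsClosedOp T) (hR : Disjoint (poleSet R) (sSpectrum T))
    (hR₁ : Disjoint (poleSet R₁) (sSpectrum T)) :
    opComp (ratOp R T) (ratOp R₁ T) ≤ ratOp (R * R₁) T := by
  obtain ⟨D, τ, h⟩ := exists_isRestriction T
  have hQ := h.boundedlyInvertible_denom hT hR
  have hQ₁ := h.boundedlyInvertible_denom hT hR₁
  refine LinearPMap.le_of_le_graph fun ⟨v, w⟩ hvw => ?_
  obtain ⟨z, hz, rfl⟩ := (hQ.mul hQ₁).exists_aeval_eq v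
  obtain ⟨hzP₁, hzP, hw⟩ := (h.mem_graph_opComp_ratOp hT hQ hQ₁ hz).1 hvw
  refine (h.mem_graph_ratOp hT (hQ.mul hQ₁) (mul_eq_num_mul_num_div R R₁) hz).2 ⟨?_, hw⟩
  rcases eq_or_ne R.num 0 with hP | hP
  · simp [hP, powDomain_zero]
  rcases eq_or_ne R₁.num 0 with hP₁ | hP₁
  · simp [hP₁, powDomain_zero]
  rwa [natDegree_mul hP hP₁, add_comm,
    ← aeval_mem_powDomain_iff hP₁ (powDomain_anti (Nat.le_add_left _ _) hzP₁)]

theorem opComp_ratOp_eq (hT : IsClosedOp T) (hR : Disjoint (poleSet R) (sSpectrum T))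
    (hR₁ : Disjoint (poleSet R₁) (sSpectrum T)) (hR₀ : R ≠ 0)
    (hdeg : 0 ≤ R.intDegree * R₁.intDegree) :
    opComp (ratOp R T) (ratOp R₁ T) = ratOp (R * R₁) T := by
  obtain ⟨D, τ, h⟩ := exists_isRestriction T
  have hQ := h.boundedlyInvertible_denom hT hR
  have hQ₁ := h.boundedlyInvertible_denom hT hR₁
  refine le_antisymm (opComp_ratOp_le hT hR hR₁)
    (LinearPMap.le_of_le_graph fun ⟨v, w⟩ hvw => ?_)
  obtain ⟨z, hz, rfl⟩ := (hQ.mul hQ₁).exists_aeval_eq v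
  obtain ⟨hzP, hw⟩ :=
    (h.mem_graph_ratOp hT (hQ.mul hQ₁) (mul_eq_num_mul_num_div R R₁) hz).1 hvw
  refine (h.mem_graph_opComp_ratOp hT hQ hQ₁ hz).2 ?_
  rw [natDegree_mul hQ.1 hQ₁.1] at hz
  rcases eq_or_ne R₁ 0 with rfl | hR₁₀
  · simp [powDomain_anti (Nat.le_add_right _ _) hz, ← hw]
  rw [natDegree_mul (RatFunc.num_ne_zero hR₀) (RatFunc.num_ne_zero hR₁₀)] at hzP
  refine ⟨?_, aeval_mem_powDomain hzP (add_comm _ _).le, hw⟩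
  rcases le_or_gt R₁.num.natDegree R₁.denom.natDegree with hle | hlt
  · exact powDomain_anti (by lia) hz
  · have hle : 0 ≤ R.intDegree :=
      nonneg_of_mul_nonneg_left hdeg (by rw [RatFunc.intDegree]; lia)
    rw [RatFunc.intDegree] at hle
    exact powDomain_anti (by lia) hzP

theorem add_ratOp_le (hT : IsClosedOp T) (hR : Disjoint (poleSet R) (sSpectrum T))
    (hR₁ : Disjoint (poleSet R₁) (sSpectrum T)) :
    ratOp R T + ratOp R₁ T ≤ ratOp (R + R₁) T := by
  obtain ⟨D, τ, h⟩ := exists_isRestriction T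
  have hQ := h.boundedlyInvertible_denom hT hR
  have hQ₁ := h.boundedlyInvertible_denom hT hR₁
  refine LinearPMap.le_of_le_graph fun ⟨v, w⟩ hvw => ?_
  obtain ⟨z, hz, rfl⟩ := (hQ.mul hQ₁).exists_aeval_eq v
  obtain ⟨hzP, hzP₁, hw⟩ := (h.mem_graph_add_ratOp hT hQ hQ₁ hz).1 hvw
  refine (h.mem_graph_ratOp hT (hQ.mul hQ₁) (add_eq_num_add_num_div R R₁) hz).2 ⟨?_, hw⟩
  have hdeg := natDegree_add_le (R.num * R₁.denom) (R₁.num * R.denom)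
  have hdegP := natDegree_mul_le (p := R.num) (q := R₁.denom)
  have hdegP₁ := natDegree_mul_le (p := R₁.num) (q := R.denom)
  rcases le_max_iff.1 hdeg with hle | hle
  · exact powDomain_anti (by lia) hzP
  · exact powDomain_anti (by lia) hzP₁

theorem add_ratOp_eq (hT : IsClosedOp T) (hR : Disjoint (poleSet R) (sSpectrum T))
    (hR₁ : Disjoint (poleSet R₁) (sSpectrum T))
    (hdeg : max R.intDegree R₁.intDegree ≤ max 0 (R + R₁).intDegree) :
    ratOp R T + ratOp R₁ T = ratOp (R + R₁) T := by
  obtain ⟨D, τ, h⟩ := exists_isRestriction T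
  have hQ := h.boundedlyInvertible_denom hT hR
  have hQ₁ := h.boundedlyInvertible_denom hT hR₁
  refine le_antisymm (add_ratOp_le hT hR hR₁)
    (LinearPMap.le_of_le_graph fun ⟨v, w⟩ hvw => ?_)
  obtain ⟨z, hz, rfl⟩ := (hQ.mul hQ₁).exists_aeval_eq v
  obtain ⟨hzN, hw⟩ :=
    (h.mem_graph_ratOp hT (hQ.mul hQ₁) (add_eq_num_add_num_div R R₁) hz).1 hvw
  refine (h.mem_graph_add_ratOp hT hQ hQ₁ hz).2 ?_
  rw [natDegree_mul hQ.1 hQ₁.1] at hz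
  set N := R.num * R₁.denom + R₁.num * R.denom with hN
  have hintDegree : (R + R₁).intDegree ≤
      max 0 (N.natDegree - (R.denom.natDegree + R₁.denom.natDegree) : ℤ) := by
    rcases eq_or_ne N 0 with hN₀ | hN₀
    · simp [add_eq_num_add_num_div, ← hN, hN₀]
    · rw [add_eq_num_add_num_div, intDegree_algebraMap_div hN₀ (hQ.mul hQ₁).1,
        natDegree_mul hQ.1 hQ₁.1, Nat.cast_add]
      exact le_max_right _ _
  have hz' {k : ℕ} (hk : k ≤ max (R.denom.natDegree + R₁.denom.natDegree) N.natDegree) :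
      z ∈ powDomain D τ k :=
    (le_max_iff.1 hk).elim (fun hk => powDomain_anti hk hz) fun hk => powDomain_anti hk hzN
  unfold RatFunc.intDegree at hdeg hintDegree
  exact ⟨hz' (by lia), hz' (by lia), hw⟩

theorem mem_sResolventSet_of_aeval_num_mul_inv_mem (hT : IsClosedOp T)
    (hR : Disjoint (poleSet R) (sSpectrum T)) {s : ℍ} (hs : s ∉ poleSet R)
    (ht : aeval s R.num * (aeval s R.denom)⁻¹ ∈ sResolventSet (ratOp R T)) :
    s ∈ sResolventSet T := by
  obtain ⟨D, τ, h⟩ := exists_isRestriction T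
  have hτ := h.isClosedOp_iff.1 hT
  obtain ⟨B, hB⟩ := h.exists_isBoundedInverse_sNum hT (h.boundedlyInvertible_denom hT hR) ht
  exact h.mem_sResolventSet_iff.2 <| .sPoly_of_aeval_eq_zero hτ
    (aeval_sNum_of_eq_mul (inv_mul_cancel_right₀ hs _).symm) fun m hm hdvd =>
      hB.boundedlyInvertible_of_dvd hτ (natDegree_sNum_le _ _ _) hm hdvd

theorem isBoundedOp_of_isBoundedOp_ratOp (hT : IsClosedOp T)
    (hR : Disjoint (poleSet R) (sSpectrum T)) (hdeg : R.denom.natDegree < R.num.natDegree)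
    (hRT : IsBoundedOp (ratOp R T)) : IsBoundedOp T := by
  obtain ⟨D, τ, h⟩ := exists_isRestriction T
  have hQ := h.boundedlyInvertible_denom hT hR
  obtain ⟨B, hB⟩ := hRT
  refine h.isBoundedOp hT fun v => ?_
  obtain ⟨z, hz, rfl⟩ := hQ.exists_aeval_eq v
  have hzP := ((h.mem_graph_ratOp hT hQ R.num_div_denom.symm hz).1
    (hB ▸ mem_graph_toPMap_top.2 rfl)).1
  rw [← powDomain_one (D := D) (τ := τ)]
  exact aeval_mem_powDomain hzP hdeg

/-- If `c` is the value of `R` at `∞`, then `R(T) - c` maps into `D(T)`. -/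
theorem isBoundedOp_of_coeff_mem_sResolventSet (hT : IsClosedOp T)
    (hR : Disjoint (poleSet R) (sSpectrum T)) (hdeg : R.num.natDegree ≤ R.denom.natDegree)
    (ht : ((R.num.coeff R.denom.natDegree : ℝ) : ℍ) ∈ sResolventSet (ratOp R T)) :
    IsBoundedOp T := by
  obtain ⟨D, τ, h⟩ := exists_isRestriction T
  obtain ⟨B, hB⟩ := h.exists_isBoundedInverse_sNum hT (h.boundedlyInvertible_denom hT hR) ht
  refine h.isBoundedOp hT fun v => ?_
  rw [← hB.apply_inverse v, sNum_coe]
  set c := R.num.coeff R.denom.natDegree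
  have hcoeff : (R.num - C c * R.denom).coeff R.denom.natDegree = 0 := by
    rw [coeff_sub, coeff_C_mul, R.monic_denom.coeff_natDegree, mul_one, sub_self]
  have hle : (R.num - C c * R.denom).natDegree ≤ R.denom.natDegree :=
    (natDegree_sub_le_of_le hdeg (natDegree_C_mul_le _ _)).trans_eq (max_self _)
  rcases eq_or_ne (R.num - C c * R.denom) 0 with h₀ | h₀
  · simp [h₀]
  have hlt : (R.num - C c * R.denom).natDegree < R.denom.natDegree :=
    hle.lt_of_ne fun heq => h₀ (leadingCoeff_eq_zero.1 (by rw [leadingCoeff, heq, hcoeff]))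
  rw [← powDomain_one (D := D) (τ := τ)]
  exact aeval_mem_powDomain (hB.mem v) (by rw [natDegree_pow]; lia)

theorem ratExt_image_subset (hT : IsClosedOp T) (hR : Disjoint (poleSet R) (sSpectrum T)) :
    ratExt R '' extSSpectrum T ⊆ extSSpectrum (ratOp R T) := by
  rintro _ ⟨_, ⟨s, hs, rfl⟩ | ⟨rfl, hT'⟩, rfl⟩
  · have hpole : s ∉ poleSet R := Set.disjoint_right.1 hR hs
    have hval : ratExt R (s : OnePoint ℍ) =
        ((aeval s R.num * (aeval s R.denom)⁻¹ : ℍ) : OnePoint ℍ) := if_neg hpole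
    exact .inl ⟨_, mt (mem_sResolventSet_of_aeval_num_mul_inv_mem hT hR hpole) hs, hval.symm⟩
  · rcases lt_or_ge R.denom.natDegree R.num.natDegree with hdeg | hdeg
    · have hval : ratExt R OnePoint.infty = OnePoint.infty := if_pos hdeg
      exact .inr ⟨hval, mt (isBoundedOp_of_isBoundedOp_ratOp hT hR hdeg) hT'⟩
    · have hval : ratExt R OnePoint.infty =
          (((R.num.coeff R.denom.natDegree : ℝ) : ℍ) : OnePoint ℍ) := if_neg hdeg.not_gt
      exact .inl ⟨_, mt (isBoundedOp_of_coeff_mem_sResolventSet hT hR hdeg) hT', hval.symm⟩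

end RationalCalculus

theorem proposition3p11_general {A V : Type*} [Ring A] [Algebra ℝ A] [NormedAddCommGroup V]
    [NormedSpace ℝ V] [CompleteSpace V] [Module A V] [IsScalarTower ℝ A V]
    (R R₁ : RatFunc ℝ) (P Q P₁ Q₁ : ℝ[X]) (hR₀ : R ≠ 0) (hQ : Q ≠ 0) (hQ₁ : Q₁ ≠ 0)
    (hR : R = algebraMap ℝ[X] (RatFunc ℝ) P / algebraMap ℝ[X] (RatFunc ℝ) Q)
    (hR₁ : R₁ = algebraMap ℝ[X] (RatFunc ℝ) P₁ / algebraMap ℝ[X] (RatFunc ℝ) Q₁)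
    (T : V →ₗ.[A] V) (hT : IsClosedOp T) (hρ : (sResolventSet T).Nonempty)
    (hpole : Disjoint (poleSet R) (sSpectrum T)) :
    IsClosedOp (ratOp R T) ∧
    ratExt R '' extSSpectrum T ⊆ extSSpectrum (ratOp R T) ∧
    (Disjoint (poleSet R₁) (sSpectrum T) →
      opComp (ratOp R T) (ratOp R₁ T) ≤ ratOp (R * R₁) T ∧
      (0 ≤ ((P.natDegree : ℤ) - Q.natDegree) * ((P₁.natDegree : ℤ) - Q₁.natDegree) →
        opComp (ratOp R T) (ratOp R₁ T) = ratOp (R * R₁) T) ∧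
      ratOp R T + ratOp R₁ T ≤ ratOp (R + R₁) T ∧
      ((P * Q₁ + P₁ * Q).natDegree = max (P * Q₁).natDegree (P₁ * Q).natDegree →
        ratOp R T + ratOp R₁ T = ratOp (R + R₁) T)) := by
  refine ⟨isClosedOp_ratOp hT hρ hpole, ratExt_image_subset hT hpole, fun hpole₁ => ?_⟩
  refine ⟨opComp_ratOp_le hT hpole hpole₁, fun hdeg => ?_, add_ratOp_le hT hpole hpole₁,
    fun hdeg => ?_⟩
  · exact opComp_ratOp_eq hT hpole hpole₁ hR₀ (intDegree_mul_intDegree_nonneg hQ hQ₁ hR hR₁ hdeg)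
  · exact add_ratOp_eq hT hpole hpole₁ (max_intDegree_le hQ hQ₁ hR hR₁ hdeg)

theorem proposition3p11 {V : Type*} [NormedAddCommGroup V] [NormedSpace ℝ V] [CompleteSpace V]
    [Module ℍ V] [Module ℍᵐᵒᵖ V] [SMulCommClass ℍ ℍᵐᵒᵖ V]
    [IsScalarTower ℝ ℍ V] [IsScalarTower ℝ ℍᵐᵒᵖ V] [ContinuousSMul ℍ V] [ContinuousSMul ℍᵐᵒᵖ V]
    (R R₁ : RatFunc ℝ) (P Q P₁ Q₁ : ℝ[X]) (hR₀ : R ≠ 0) (hQ : Q ≠ 0) (hQ₁ : Q₁ ≠ 0)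
    (hR : R = algebraMap ℝ[X] (RatFunc ℝ) P / algebraMap ℝ[X] (RatFunc ℝ) Q)
    (hR₁ : R₁ = algebraMap ℝ[X] (RatFunc ℝ) P₁ / algebraMap ℝ[X] (RatFunc ℝ) Q₁) :
    -- right linear operators
    (∀ T : V →ₗ.[ℍᵐᵒᵖ] V, IsClosedOp T → (sResolventSet T).Nonempty →
      Disjoint (poleSet R) (sSpectrum T) →
      IsClosedOp (ratOp R T) ∧
      ratExt R '' extSSpectrum T ⊆ extSSpectrum (ratOp R T) ∧
      (Disjoint (poleSet R₁) (sSpectrum T) →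
        opComp (ratOp R T) (ratOp R₁ T) ≤ ratOp (R * R₁) T ∧
        (0 ≤ ((P.natDegree : ℤ) - Q.natDegree) * ((P₁.natDegree : ℤ) - Q₁.natDegree) →
          opComp (ratOp R T) (ratOp R₁ T) = ratOp (R * R₁) T) ∧
        ratOp R T + ratOp R₁ T ≤ ratOp (R + R₁) T ∧
        ((P * Q₁ + P₁ * Q).natDegree = max (P * Q₁).natDegree (P₁ * Q).natDegree →
          ratOp R T + ratOp R₁ T = ratOp (R + R₁) T))) ∧
    -- left linear operators
    (∀ T : V →ₗ.[ℍ] V, IsClosedOp T → (sResolventSet T).Nonempty →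
      Disjoint (poleSet R) (sSpectrum T) →
      IsClosedOp (ratOp R T) ∧
      ratExt R '' extSSpectrum T ⊆ extSSpectrum (ratOp R T) ∧
      (Disjoint (poleSet R₁) (sSpectrum T) →
        opComp (ratOp R T) (ratOp R₁ T) ≤ ratOp (R * R₁) T ∧
        (0 ≤ ((P.natDegree : ℤ) - Q.natDegree) * ((P₁.natDegree : ℤ) - Q₁.natDegree) →
          opComp (ratOp R T) (ratOp R₁ T) = ratOp (R * R₁) T) ∧
        ratOp R T + ratOp R₁ T ≤ ratOp (R + R₁) T ∧
        ((P * Q₁ + P₁ * Q).natDegree = max (P * Q₁).natDegree (P₁ * Q).natDegree →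
          ratOp R T + ratOp R₁ T = ratOp (R + R₁) T))) := by
  exact ⟨proposition3p11_general R R₁ P Q P₁ Q₁ hR₀ hQ hQ₁ hR hR₁,
    proposition3p11_general R R₁ P Q P₁ Q₁ hR₀ hQ hQ₁ hR hR₁⟩
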